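/- Let $k$ be a field, $n\ge 0$, let $M$ be a matroid on the ground set $[n]=\{1,\dots,n\}$, and let $W\subseteq k^n$ be a $k$-linear realization of $M$, i.e. a linear subspace such that, for every $B\subseteq[n]$, the coordinate projection $W\to k^B$ is an isomorphism if and only if $B$ is a basis of $M$. Let $r$ be the rank of $M$ (so $r=\dim W$). Let $$W^\perp=(k^n/W)^*=\Big\{v\in k^n : \sum_{i} v_iw_i=0\ \text{ for all } w\in W\Big\},$$ let $f_i\in W^*$ and $g_i\in (W^\perp)^*$ be the restrictions of the $i$-th coordinate function of $k^n$ to $W$ and to $W^\perp$, respectively, let $k[W]=\operatorname{Sym}(W^*)$ and $k[W^\perp]=\operatorname{Sym}((W^\perp)^*)$ be the coordinate rings, and put $S=k[W]\otimes_k k[W^\perp]$, which is a polynomial ring in $n$ variables. Let $$\mathfrak a=(f_1g_1,\dots,f_ng_n)\subseteq S$$ be the ideal of pairs. A flat of $M$ is called cyclic if it is a union of circuits of $M$; let $\mathrm{cyc}(M)$ be the set of cyclic flats. Then $$\operatorname{pdim}_S(S/\mathfrak a)\ \ge\ \max\{\,2\operatorname{rank}_M(F)-|F|+n-r \;:\;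 F\in\mathrm{cyc}(M)\,\}.$$ In particular, this holds for the hyperplane arrangement $\{\ker f_i\}_{i\in[n]}$ in $W$ whenever $M$ has no loops, i.e. all $f_i\neq 0$. -/

import Mathlib

namespace IdealOfPairs

universe u

/-- `W` is a `k`-linear realization of the matroid `M` on the ground set `Fin n`: the coordinate
projection `W → k^B` is an isomorphism exactly when `B` is a basis of `M`. -/
def IsLinearRealization {k : Type u} [Field k] {n : ℕ}
    (W : Submodule k (Fin n → k)) (M : Matroid (Fin n)) : Prop :=
  M.E = Set.univ ∧
    ∀ B : Set (Fin n),
      M.IsBase B ↔ Function.Bijective (fun (w : W) (i : B) => (w : Fin n → k) i)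

/-- A cyclic flat of `M`: a flat which is a union of circuits. -/
def IsCyclicFlat {α : Type*} (M : Matroid α) (F : Set α) : Prop :=
  M.IsFlat F ∧ ∃ 𝒞 : Set (Set α), (∀ C ∈ 𝒞, M.IsCircuit C) ∧ F = ⋃₀ 𝒞

/-- The dual realization `W^⊥ = (k^n / W)^*`, regarded as a subspace of `k^n` through the standard
basis: the vectors `v` with `∑ i, v i * w i = 0` for all `w ∈ W`. -/
def perp {k : Type u} [Field k] {n : ℕ} (W : Submodule k (Fin n → k)) :
    Submodule k (Fin n → k) where
  carrier := {v | ∀ w ∈ W, ∑ i, v i * w i = 0}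
  zero_mem' := by simp
  add_mem' := by
    intro a b ha hb w hw
    simp [add_mul, Finset.sum_add_distrib, ha w hw, hb w hw]
  smul_mem' := by
    intro c a ha w hw
    simp [mul_assoc, ← Finset.mul_sum, ha w hw]

/-- The restriction to the subspace `U` of the `i`-th coordinate function of `k^n`. -/
def coordForm {k : Type u} [Field k] {n : ℕ} (U : Submodule k (Fin n → k)) (i : Fin n) :
    Module.Dual k U :=
  (LinearMap.proj i).comp U.subtype

/-- The coordinate ring `k[U]` of a linear space `U`, the symmetric algebra of the dual of `U`. -/
abbrev CoordRing {k : Type u} [Field k] {n : ℕ} (U : Submodule k (Fin n → k)) : Type u :=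
  SymmetricAlgebra k (Module.Dual k U)

/-- The ring `S = k[W] ⊗ k[W^⊥]`, a polynomial ring in `n` variables over `k`. -/
abbrev PairRing {k : Type u} [Field k] {n : ℕ} (W : Submodule k (Fin n → k)) : Type u :=
  TensorProduct k (CoordRing W) (CoordRing (perp W))

/-- The linear form `f i`, the `i`-th coordinate function on `W`, as an element of `S`. -/
noncomputable def f {k : Type u} [Field k] {n : ℕ} (W : Submodule k (Fin n → k)) (i : Fin n) :
    PairRing W :=
  TensorProduct.tmul k (SymmetricAlgebra.ι k _ (coordForm W i)) 1

/-- The linear form `g i`, the `i`-th coordinate function on `W^⊥`, as an element of `S`. -/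
noncomputable def g {k : Type u} [Field k] {n : ℕ} (W : Submodule k (Fin n → k)) (i : Fin n) :
    PairRing W :=
  TensorProduct.tmul k 1 (SymmetricAlgebra.ι k _ (coordForm (perp W) i))

/-- The ideal of pairs `(f 1 * g 1, …, f n * g n)` of `S`. -/
noncomputable def idealOfPairs {k : Type u} [Field k] {n : ℕ} (W : Submodule k (Fin n → k)) :
    Ideal (PairRing W) :=
  Ideal.span (Set.range fun i => f W i * g W i)

end IdealOfPairs

/-!
For a cyclic flat `F`, let `P` be the ideal generated by the linear forms `f i` with `i ∈ F` and
`g i` with `i ∉ F`. It is prime, generated by a regular sequence of `rk F + rk* Fᶜ` linear forms,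
where `rk*` is the rank in the dual matroid, realized by `W^⊥`. As `F` is a flat, `f i ∉ P` for
`i ∉ F`; as `F` is a union of circuits, `Fᶜ` is a flat of the dual, so `g i ∉ P` for `i ∈ F`. Hence
every generator of `P` is multiplied into `𝔞` by an element outside `P`, and `𝔞` and `P` agree
after localizing at `P`. There `S / 𝔞` becomes a quotient by a regular sequence, whose projective
dimension is the length `rk F + rk* Fᶜ = 2 rk F - |F| + n - r` of the sequence.
-/

namespace IdealOfPairs

open CategoryTheory Module TensorProduct

section CommRing

universe v

variable {R : Type v} [CommRing R]

theorem ofList_ofFn {m : ℕ} (r : Fin m → R) :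
    Ideal.ofList (List.ofFn r) = Ideal.span (Set.range r) := by
  simp only [Ideal.ofList, List.mem_ofFn]
  rfl

theorem map_eq_map_span_of_exists_mul_mem (S : Submonoid R) (A : Type*) [CommRing A] [Algebra R A]
    [IsLocalization S A] {I : Ideal R} {Y : Set R} (hIY : I ≤ Ideal.span Y)
    (hY : ∀ y ∈ Y, ∃ s ∈ S, s * y ∈ I) :
    I.map (algebraMap R A) = (Ideal.span Y).map (algebraMap R A) := by
  refine le_antisymm (Ideal.map_mono hIY) ?_
  rw [Ideal.map_span, Ideal.span_le]
  rintro _ ⟨y, hy, rfl⟩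
  obtain ⟨s, hs, hsy⟩ := hY y hy
  have hunit : IsUnit (algebraMap R A s) := IsLocalization.map_units A ⟨s, hs⟩
  rw [SetLike.mem_coe, ← Ideal.unit_mul_mem_iff_mem _ hunit, ← map_mul]
  exact Ideal.mem_map_of_mem _ hsy

/-- Localization commutes with quotients, `S⁻¹(R ⧸ I) ≃ S⁻¹R ⧸ I S⁻¹R`; the left-hand side is the
categorical localized module, to which the bound on projective dimensions applies. -/
noncomputable def localizedModuleQuotientEquiv (I : Ideal R) (S : Submonoid R) :
    (ModuleCat.of R (R ⧸ I)).localizedModule S ≃ₗ[Localization S]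
      Localization S ⧸ I.map (algebraMap R (Localization S)) :=
  have : IsLocalizedModule S ((ModuleCat.of R (R ⧸ I)).localizedModuleMkLinearMap S) :=
    ModuleCat.localizedModule_isLocalizedModule _ S
  LinearEquiv.extendScalarsOfIsLocalization S (Localization S)
      (IsLocalizedModule.linearEquiv S ((ModuleCat.of R (R ⧸ I)).localizedModuleMkLinearMap S)
        (I.toLocalizedQuotient' (Localization S) S (Algebra.linearMap R (Localization S)))) ≪≫ₗ
    Submodule.quotEquivOfEq _ _ (Ideal.localized'_eq_map (Localization S) S I)

theorem length_le_projectiveDimension_quotient [IsNoetherianRing R] {P I : Ideal R} [P.IsPrime]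
    {rs : List R} (hrs : RingTheory.Sequence.IsWeaklyRegular R rs) (hP : Ideal.ofList rs = P)
    (hI : I.map (algebraMap R (Localization.AtPrime P)) =
      P.map (algebraMap R (Localization.AtPrime P))) :
    (rs.length : WithBot ℕ∞) ≤ projectiveDimension (ModuleCat.of R (R ⧸ I)) := by
  let A := Localization.AtPrime P
  let rs' := rs.map (algebraMap R A)
  have hreg : RingTheory.Sequence.IsRegular A rs' :=
    hrs.isRegular_of_isLocalization_of_mem A P fun r hr => hP.le (Ideal.subset_span hr)
  have hI' : I.map (algebraMap R A) = Ideal.ofList rs' := by rw [hI, ← Ideal.map_ofList, hP]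
  let e : (ModuleCat.of R (R ⧸ I)).localizedModule P.primeCompl ≃ₗ[A]
      Shrink.{v} (A ⧸ Ideal.ofList rs') :=
    localizedModuleQuotientEquiv I P.primeCompl ≪≫ₗ Submodule.quotEquivOfEq _ _ hI' ≪≫ₗ
      (Shrink.linearEquiv A _).symm
  calc (rs.length : WithBot ℕ∞) = rs'.length := by rw [List.length_map]
    _ = projectiveDimension (ModuleCat.of A (Shrink.{v} (A ⧸ Ideal.ofList rs'))) :=
        (ModuleCat.projectiveDimension_quotient_eq_length rs' hreg).symm
    _ = projectiveDimension ((ModuleCat.of R (R ⧸ I)).localizedModule P.primeCompl) :=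
        (projectiveDimension_eq_of_iso e.toModuleIso).symm
    _ ≤ projectiveDimension (ModuleCat.of R (R ⧸ I)) :=
        ModuleCat.projectiveDimension_le_projectiveDimension_of_isLocalizedModule _ _

end CommRing

section SymmetricAlgebra

variable {K V A : Type*} [Field K] [AddCommGroup V] [Module K V] [CommRing A] [Algebra K A]

theorem span_image_span (φ : V →ₗ[K] A) (s : Set V) :
    Ideal.span (φ '' (Submodule.span K s : Set V)) = Ideal.span (φ '' s) := by
  refine le_antisymm (Ideal.span_le.2 ?_) (Ideal.span_mono (Set.image_mono Submodule.subset_span))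
  have h : Submodule.span K s ≤ ((Ideal.span (φ '' s)).restrictScalars K).comap φ :=
    Submodule.span_le.2 fun v hv => Ideal.subset_span ⟨v, hv, rfl⟩
  rintro _ ⟨v, hv, rfl⟩
  exact h hv

variable {φ : V →ₗ[K] A} (h : IsSymmetricAlgebra φ)
include h

theorem ker_lift_mkQ (U : Submodule K V) :
    RingHom.ker (h.lift (SymmetricAlgebra.ι K _ ∘ₗ U.mkQ)) = Ideal.span (φ '' U) := by
  set q := h.lift (SymmetricAlgebra.ι K _ ∘ₗ U.mkQ)
  set J := Ideal.span (φ '' (U : Set V))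
  let p : SymmetricAlgebra K (V ⧸ U) →ₐ[K] A ⧸ J := SymmetricAlgebra.lift <|
    U.liftQ ((Ideal.Quotient.mkₐ K J).toLinearMap ∘ₗ φ) fun v hv =>
      Ideal.Quotient.eq_zero_iff_mem.2 (Ideal.subset_span ⟨v, hv, rfl⟩)
  have hpq : p.comp q = Ideal.Quotient.mkₐ K J := h.algHom_ext <| LinearMap.ext fun v => by
    change p (q (φ v)) = _
    rw [h.lift_eq]
    exact SymmetricAlgebra.lift_ι_apply ..
  refine le_antisymm (fun a ha => ?_) (Ideal.span_le.2 ?_)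
  · have hpa : p (q a) = Ideal.Quotient.mkₐ K J a := DFunLike.congr_fun hpq a
    rw [RingHom.mem_ker.1 ha, map_zero] at hpa
    exact Ideal.Quotient.eq_zero_iff_mem.1 hpa.symm
  · rintro _ ⟨v, hv, rfl⟩
    have hv' : U.mkQ v = 0 := (Submodule.Quotient.mk_eq_zero U).2 hv
    simp [q, h.lift_eq, hv']

theorem isPrime_span_image (s : Set V) : (Ideal.span (φ '' s)).IsPrime := by
  rw [← span_image_span, ← ker_lift_mkQ h]
  exact RingHom.ker_isPrime _

theorem map_mem_span_image_iff {s : Set V} {v : V} :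
    φ v ∈ Ideal.span (φ '' s) ↔ v ∈ Submodule.span K s := by
  refine ⟨fun hv => ?_, fun hv => span_image_span φ s ▸ Ideal.subset_span ⟨v, hv, rfl⟩⟩
  by_contra hvs
  obtain ⟨l, hlv, hls⟩ := Submodule.exists_le_ker_of_notMem hvs
  have hle : Ideal.span (φ '' s) ≤ RingHom.ker (h.lift l) := by
    rw [Ideal.span_le]
    rintro _ ⟨w, hw, rfl⟩
    exact (h.lift_eq l w).trans (hls (Submodule.subset_span hw))
  exact hlv ((h.lift_eq l v).symm.trans (hle hv))

theorem isWeaklyRegular_ofFn {m : ℕ} {v : Fin m → V} (hv : LinearIndependent K v) :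
    RingTheory.Sequence.IsWeaklyRegular A (List.ofFn (φ ∘ v)) := by
  induction m with
  | zero => simp
  | succ m ih =>
    have hinit : LinearIndependent K (v ∘ Fin.castSucc) := hv.comp _ (Fin.castSucc_injective m)
    have hlast : v (Fin.last m) ∉ Submodule.span K (Set.range (v ∘ Fin.castSucc)) := by
      rw [Set.range_comp]
      exact hv.notMem_span_image (by simp)
    rw [List.ofFn_succ_last, RingTheory.Sequence.isWeaklyRegular_append_iff,
      RingTheory.Sequence.isWeaklyRegular_singleton_iff, isSMulRegular_quotient_iff_mem_of_smul_mem]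
    refine ⟨ih hinit, fun x hx => ?_⟩
    have hspan : Ideal.ofList (List.ofFn fun i : Fin m => (φ ∘ v) i.castSucc) =
        Ideal.span (φ '' Set.range (v ∘ Fin.castSucc)) := by
      rw [ofList_ofFn, ← Set.range_comp]
      rfl
    rw [smul_eq_mul, Ideal.mul_top, hspan] at hx ⊢
    refine ((isPrime_span_image h _).mem_or_mem hx).resolve_left fun hmem => hlast ?_
    exact (map_mem_span_image_iff h).1 hmem

theorem isNoetherianRing_of_isSymmetricAlgebra [FiniteDimensional K V] : IsNoetherianRing A :=
  isNoetherianRing_of_ringEquiv _ <|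
    ((SymmetricAlgebra.equivMvPolynomial (finBasis K V)).symm.trans h.equiv).toRingEquiv

theorem finrank_span_le_projectiveDimension [FiniteDimensional K V] {s : Set V} {I : Ideal A}
    (hI : I ≤ Ideal.span (φ '' s))
    (hs : ∀ v ∈ s, ∃ t ∉ Ideal.span (φ '' s), t * φ v ∈ I) :
    (finrank K (Submodule.span K s) : WithBot ℕ∞) ≤
      projectiveDimension (ModuleCat.of A (A ⧸ I)) := by
  have := isNoetherianRing_of_isSymmetricAlgebra h
  have := isPrime_span_image h s
  let b := finBasis K (Submodule.span K s)
  let v : Fin (finrank K (Submodule.span K s)) → V := Submodule.subtype _ ∘ b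
  have hv : LinearIndependent K v := b.linearIndependent.map' _ (Submodule.ker_subtype _)
  have hspan : Submodule.span K (Set.range v) = Submodule.span K s := by
    rw [Set.range_comp, Submodule.span_image, b.span_eq, Submodule.map_subtype_top]
  have hP : Ideal.ofList (List.ofFn (φ ∘ v)) = Ideal.span (φ '' s) := by
    rw [ofList_ofFn, Set.range_comp, ← span_image_span, hspan, span_image_span]
  have hloc := map_eq_map_span_of_exists_mul_mem (Ideal.span (φ '' s)).primeCompl
    (Localization.AtPrime (Ideal.span (φ '' s))) hI (by rintro _ ⟨v, hv, rfl⟩; exact hs v hv)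
  simpa using length_le_projectiveDimension_quotient (isWeaklyRegular_ofFn h hv) hP hloc

end SymmetricAlgebra

section TensorProduct

variable {R M N A B : Type*} [CommRing R] [AddCommGroup M] [Module R M] [AddCommGroup N]
  [Module R N] [CommRing A] [Algebra R A] [CommRing B] [Algebra R B]

/-- The linear map `(m, n) ↦ φ m ⊗ 1 + 1 ⊗ ψ n`, which exhibits `A ⊗ B` as the symmetric algebra of
`M × N` when `φ` and `ψ` exhibit `A` and `B` as those of `M` and `N`. -/
noncomputable def tensorCoprod (φ : M →ₗ[R] A) (ψ : N →ₗ[R] B) : M × N →ₗ[R] A ⊗[R] B :=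
  (Algebra.TensorProduct.includeLeft.toLinearMap ∘ₗ φ).coprod
    (Algebra.TensorProduct.includeRight.toLinearMap ∘ₗ ψ)

theorem isSymmetricAlgebra_tensorCoprod {φ : M →ₗ[R] A} {ψ : N →ₗ[R] B}
    (hφ : IsSymmetricAlgebra φ) (hψ : IsSymmetricAlgebra ψ) :
    IsSymmetricAlgebra (tensorCoprod φ ψ) := by
  let inv : A ⊗[R] B →ₐ[R] SymmetricAlgebra R (M × N) := Algebra.TensorProduct.productMap
    (hφ.lift (SymmetricAlgebra.ι R (M × N) ∘ₗ LinearMap.inl R M N))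
    (hψ.lift (SymmetricAlgebra.ι R (M × N) ∘ₗ LinearMap.inr R M N))
  have hleft : inv.comp (SymmetricAlgebra.lift (tensorCoprod φ ψ)) = .id R _ := by
    ext <;> simp [inv, tensorCoprod, hφ.lift_eq, hψ.lift_eq]
  have hright : (SymmetricAlgebra.lift (tensorCoprod φ ψ)).comp inv = .id R _ := by
    refine Algebra.TensorProduct.ext (hφ.algHom_ext ?_) (hψ.algHom_ext ?_) <;> ext <;>
      simp [inv, tensorCoprod, hφ.lift_eq, hψ.lift_eq]
  exact (AlgEquiv.ofAlgHom _ inv hright hleft).bijective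

end TensorProduct

theorem finrank_submodule_prod {K V V' : Type*} [DivisionRing K] [AddCommGroup V] [Module K V]
    [AddCommGroup V'] [Module K V'] (p : Submodule K V) (q : Submodule K V')
    [FiniteDimensional K p] [FiniteDimensional K q] :
    finrank K (p.prod q) = finrank K p + finrank K q := by
  have hinj : Function.Injective (p.subtype.prodMap q.subtype) :=
    p.injective_subtype.prodMap q.injective_subtype
  have hrange := LinearMap.range_prodMap p.subtype q.subtype
  rw [p.range_subtype, q.range_subtype] at hrange
  rw [← hrange, LinearMap.finrank_range_of_inj hinj, finrank_prod]

section DualFamilies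

variable {K V ι : Type*} [Field K] [AddCommGroup V] [Module K V]

theorem injective_pi_iff_span_eq_top [FiniteDimensional K V] {φ : ι → Dual K V} :
    Function.Injective (LinearMap.pi φ) ↔ Submodule.span K (Set.range φ) = ⊤ := by
  have hker : LinearMap.ker (LinearMap.pi φ) =
      (Submodule.span K (Set.range φ)).dualCoannihilator := by
    refine SetLike.coe_injective ?_
    ext v
    simp [funext_iff]
  rw [← LinearMap.ker_eq_bot, hker]
  refine ⟨fun h => ?_, fun h => by rw [h, Submodule.dualCoannihilator_top]⟩
  rw [← Subspace.dualCoannihilator_dualAnnihilator_eq (W := Submodule.span K (Set.range φ)), h,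
    Submodule.dualAnnihilator_bot]

theorem bijective_pi_iff [FiniteDimensional K V] [Finite ι] {φ : ι → Dual K V} :
    Function.Bijective (LinearMap.pi φ) ↔
      LinearIndependent K φ ∧ Submodule.span K (Set.range φ) = ⊤ := by
  have := Fintype.ofFinite ι
  have hcard : finrank K (ι → K) = Fintype.card ι := finrank_fintype_fun_eq_card K
  rw [linearIndependent_iff_card_eq_finrank_span, Set.finrank, ← injective_pi_iff_span_eq_top]
  refine ⟨fun h => ⟨?_, h.1⟩, fun ⟨hc, hinj⟩ => ⟨hinj, ?_⟩⟩
  · rw [injective_pi_iff_span_eq_top.1 h.1, finrank_top, Subspace.dual_finrank_eq, ← hcard]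
    exact (LinearEquiv.ofBijective _ h).finrank_eq.symm
  · rw [injective_pi_iff_span_eq_top.1 hinj, finrank_top, Subspace.dual_finrank_eq, ← hcard] at hc
    exact (LinearMap.injective_iff_surjective_of_finrank_eq_finrank hc.symm).1 hinj

end DualFamilies

section Perp

variable {k : Type*} [Field k] {n : ℕ}

theorem span_range_coordForm (U : Submodule k (Fin n → k)) :
    Submodule.span k (Set.range (coordForm U)) = ⊤ :=
  injective_pi_iff_span_eq_top.1 fun _ _ h => Subtype.ext h

theorem perp_eq_orthogonal (W : Submodule k (Fin n → k)) :
    perp W = (Matrix.toBilin' (1 : Matrix (Fin n) (Fin n) k)).orthogonal W := by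
  ext v
  simp [perp, LinearMap.BilinForm.mem_orthogonal_iff,
    Matrix.toBilin'_apply', dotProduct, mul_comm]

theorem nondegenerate_toBilin'_one :
    (Matrix.toBilin' (1 : Matrix (Fin n) (Fin n) k)).Nondegenerate :=
  LinearMap.BilinForm.nondegenerate_toBilin'_of_det_ne_zero' _ (by simp)

theorem finrank_perp (W : Submodule k (Fin n → k)) : finrank k (perp W) = n - finrank k W := by
  rw [perp_eq_orthogonal, LinearMap.BilinForm.finrank_orthogonal nondegenerate_toBilin'_one,
    finrank_fin_fun]

theorem perp_perp (W : Submodule k (Fin n → k)) : perp (perp W) = W := by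
  rw [perp_eq_orthogonal, perp_eq_orthogonal]
  refine LinearMap.BilinForm.orthogonal_orthogonal nondegenerate_toBilin'_one (fun v w h => ?_) W
  simpa [Matrix.toBilin'_apply', dotProduct_comm] using h

theorem bijective_restrict_perp {W : Submodule k (Fin n → k)} {B C : Set (Fin n)}
    (hBC : IsCompl B C) (hB : Function.Bijective (fun (w : W) (i : B) => (w : Fin n → k) i)) :
    Function.Bijective (fun (v : perp W) (i : C) => (v : Fin n → k) i) := by
  classical
  obtain rfl : Bᶜ = C := hBC.compl_eq
  let π : W →ₗ[k] (B → k) := LinearMap.pi fun i => coordForm W i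
  let π' : perp W →ₗ[k] ((Bᶜ : Set (Fin n)) → k) := LinearMap.pi fun i => coordForm (perp W) i
  have hinj : Function.Injective π' := by
    refine (injective_iff_map_eq_zero π').2 fun v hv => Subtype.ext (funext fun i => ?_)
    have hvB : ∀ j ∉ B, (v : Fin n → k) j = 0 := fun j hj => congrFun hv ⟨j, hj⟩
    by_cases hi : i ∈ B
    · obtain ⟨w, hw⟩ := hB.2 (Pi.single ⟨i, hi⟩ 1)
      have hwB : ∀ j (hj : j ∈ B), (w : Fin n → k) j = (Pi.single ⟨i, hi⟩ 1 : B → k) ⟨j, hj⟩ :=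
        fun j hj => congrFun hw ⟨j, hj⟩
      calc (v : Fin n → k) i = (v : Fin n → k) i * (w : Fin n → k) i := by simp [hwB i hi]
        _ = ∑ j, (v : Fin n → k) j * (w : Fin n → k) j := by
          rw [Fintype.sum_eq_single i]
          intro j hji
          by_cases hj : j ∈ B
          · simp [hwB j hj, hji]
          · simp [hvB j hj]
        _ = 0 := v.2 w w.2
    · exact hvB i hi
  have hcard : finrank k (perp W) = finrank k ((Bᶜ : Set (Fin n)) → k) := by
    have hW : finrank k W = finrank k (B → k) := (LinearEquiv.ofBijective π hB).finrank_eq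
    rw [finrank_perp, hW, finrank_fintype_fun_eq_card, finrank_fintype_fun_eq_card,
      Fintype.card_compl_set, Fintype.card_fin]
  exact ⟨hinj, (LinearMap.injective_iff_surjective_of_finrank_eq_finrank hcard).1 hinj⟩

end Perp

section Matroid

theorem isCyclicFlat_loops {α : Type*} (M : Matroid α) : IsCyclicFlat M M.loops := by
  refine ⟨M.isFlat_closure ∅, (fun e => {e}) '' M.loops, ?_, by simp⟩
  rintro _ ⟨e, he, rfl⟩
  exact Matroid.singleton_isCircuit.2 he

theorem IsCyclicFlat.isFlat_dual_compl {α : Type*} {M : Matroid α} {F : Set α}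
    (hF : IsCyclicFlat M F) : M✶.IsFlat (M.E \ F) := by
  obtain ⟨-, 𝒞, h𝒞, rfl⟩ := hF
  refine Matroid.isFlat_iff_closure_eq.2 (Set.Subset.antisymm (fun e he => ?_)
    (M✶.subset_closure _ Set.sdiff_subset))
  by_contra heF
  obtain ⟨K, hKF, hK, heK⟩ := (Matroid.mem_closure_iff_exists_isCircuit heF).1 he
  have heE : e ∈ M.E := M✶.closure_subset_ground _ he
  obtain ⟨C, hC, heC⟩ : e ∈ ⋃₀ 𝒞 := by_contra fun h => heF ⟨heE, h⟩
  refine (h𝒞 C hC).inter_isCocircuit_ne_singleton hK (e := e) ?_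
  refine Set.Subset.antisymm (fun x hx => ?_) (Set.singleton_subset_iff.2 ⟨heC, heK⟩)
  exact (hKF hx.2).resolve_right fun h => h.2 ⟨C, hC, hx.1⟩

theorem toNat_eRk_add_toNat_eRk_dual {n : ℕ} {M : Matroid (Fin n)} (hM : M.E = Set.univ)
    (F : Set (Fin n)) :
    (((M.eRk F).toNat + (M✶.eRk Fᶜ).toNat : ℕ) : ℤ) =
      2 * ((M.eRk F).toNat : ℤ) - (F.ncard : ℤ) + (n : ℤ) - (M.eRank.toNat : ℤ) := by
  have hdual := M.eRk_dual_add_eRank Fᶜ (hM ▸ Set.subset_univ _)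
  rw [hM, ← Set.compl_eq_univ_sdiff, compl_compl] at hdual
  have hnat := congrArg ENat.toNat hdual
  rw [ENat.toNat_add (M✶.isRkFinite_set _).eRk_lt_top.ne (M.eRank_ne_top_iff.2 inferInstance),
    ENat.toNat_add (M.isRkFinite_set _).eRk_lt_top.ne (Set.toFinite _).encard_lt_top.ne,
    ← Set.ncard_def] at hnat
  have hcard := Set.ncard_add_ncard_compl F
  rw [Nat.card_fin] at hcard
  omega

end Matroid

namespace IsLinearRealization

variable {k : Type*} [Field k] {n : ℕ} {W : Submodule k (Fin n → k)} {M : Matroid (Fin n)}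

theorem dual (hW : IsLinearRealization W M) : IsLinearRealization (perp W) M✶ := by
  refine ⟨hW.1, fun B => ?_⟩
  rw [Matroid.dual_isBase_iff', hW.1, ← Set.compl_eq_univ_sdiff, and_iff_left (Set.subset_univ B),
    hW.2]
  refine ⟨bijective_restrict_perp isCompl_compl.symm, fun h => ?_⟩
  have h' := bijective_restrict_perp (isCompl_compl (x := B)) h
  rwa [perp_perp] at h'

theorem isBase_iff (hW : IsLinearRealization W M) {B : Set (Fin n)} :
    M.IsBase B ↔
      LinearIndepOn k (coordForm W) B ∧ Submodule.span k (coordForm W '' B) = ⊤ := by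
  rw [hW.2 B, Set.image_eq_range]
  exact bijective_pi_iff (φ := fun i : B => coordForm W i)

theorem indep_iff (hW : IsLinearRealization W M) {I : Set (Fin n)} :
    M.Indep I ↔ LinearIndepOn k (coordForm W) I := by
  refine ⟨fun hI => ?_, fun hI => ?_⟩
  · obtain ⟨B, hB, hIB⟩ := hI.exists_isBase_superset
    exact (hW.isBase_iff.1 hB).1.mono hIB
  · obtain ⟨B, -, hIB, hspan, hB⟩ := exists_linearIndepOn_extension hI (Set.subset_univ I)
    rw [Set.image_univ, ← Submodule.span_le, span_range_coordForm, top_le_iff] at hspan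
    exact (hW.isBase_iff.2 ⟨hB, hspan⟩).indep.subset hIB

theorem subset_ground (hW : IsLinearRealization W M) (F : Set (Fin n)) : F ⊆ M.E :=
  hW.1 ▸ Set.subset_univ F

theorem span_image_eq_of_isBasis (hW : IsLinearRealization W M) {I F : Set (Fin n)}
    (hI : M.IsBasis I F) :
    Submodule.span k (coordForm W '' I) = Submodule.span k (coordForm W '' F) := by
  refine le_antisymm (Submodule.span_mono (Set.image_mono hI.subset)) (Submodule.span_le.2 ?_)
  rintro _ ⟨j, hj, rfl⟩
  by_contra hjspan
  have hjI : j ∉ I := fun h => hjspan (Submodule.subset_span ⟨j, h, rfl⟩)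
  refine hjI (hI.mem_of_insert_indep hj ?_)
  rw [hW.indep_iff, linearIndepOn_insert hjI, ← hW.indep_iff]
  exact ⟨hI.indep, hjspan⟩

theorem finrank_span_image (hW : IsLinearRealization W M) (F : Set (Fin n)) :
    finrank k (Submodule.span k (coordForm W '' F)) = (M.eRk F).toNat := by
  classical
  obtain ⟨I, hI⟩ := M.exists_isBasis F (hW.subset_ground F)
  rw [← hW.span_image_eq_of_isBasis hI, hI.eRk_eq_encard, Set.image_eq_range,
    finrank_span_eq_card (hW.indep_iff.1 hI.indep).linearIndependent, Fintype.card_eq_nat_card]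
  rfl

theorem notMem_span_image_of_isFlat (hW : IsLinearRealization W M) {F : Set (Fin n)}
    (hF : M.IsFlat F) {i : Fin n} (hi : i ∉ F) :
    coordForm W i ∉ Submodule.span k (coordForm W '' F) := by
  obtain ⟨I, hI⟩ := M.exists_isBasis F (hW.subset_ground F)
  have hiI : i ∉ I := fun h => hi (hI.subset h)
  have hcl : i ∉ M.closure I := by rwa [hI.closure_eq_closure, hF.closure]
  have hins : M.Indep (insert i I) :=
    (hI.indep.notMem_closure_iff_of_notMem hiI (hW.subset_ground _ (Set.mem_univ i))).1 hcl
  rw [hW.indep_iff, linearIndepOn_insert hiI, hW.span_image_eq_of_isBasis hI] at hins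
  exact hins.2

end IsLinearRealization

section PairRing

variable {k : Type*} [Field k] {n : ℕ}

/-- The inclusion into `S = k[W] ⊗ k[W^⊥]` of its linear forms `W^* × (W^⊥)^*`. -/
noncomputable def pairForm (W : Submodule k (Fin n → k)) :
    Dual k W × Dual k (perp W) →ₗ[k] PairRing W :=
  tensorCoprod (SymmetricAlgebra.ι k (Dual k W)) (SymmetricAlgebra.ι k (Dual k (perp W)))

/-- The linear forms `f i` for `i ∈ F` and `g i` for `i ∉ F`, which generate a prime ideal
containing the ideal of pairs. -/
def transversal (W : Submodule k (Fin n → k)) (F : Set (Fin n)) :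
    Set (Dual k W × Dual k (perp W)) :=
  LinearMap.inl k _ _ '' (coordForm W '' F) ∪ LinearMap.inr k _ _ '' (coordForm (perp W) '' Fᶜ)

variable (W : Submodule k (Fin n → k)) (F : Set (Fin n))

theorem isSymmetricAlgebra_pairForm : IsSymmetricAlgebra (pairForm W) :=
  isSymmetricAlgebra_tensorCoprod SymmetricAlgebra.isSymmetricAlgebra_ι
    SymmetricAlgebra.isSymmetricAlgebra_ι

theorem pairForm_inl (i : Fin n) : pairForm W (LinearMap.inl k _ _ (coordForm W i)) = f W i := by
  simp [pairForm, tensorCoprod, f]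

theorem pairForm_inr (i : Fin n) :
    pairForm W (LinearMap.inr k _ _ (coordForm (perp W) i)) = g W i := by
  simp [pairForm, tensorCoprod, g]

theorem span_transversal :
    Submodule.span k (transversal W F) =
      (Submodule.span k (coordForm W '' F)).prod
        (Submodule.span k (coordForm (perp W) '' Fᶜ)) :=
  LinearMap.span_inl_union_inr

theorem finrank_span_transversal :
    finrank k (Submodule.span k (transversal W F)) =
      finrank k (Submodule.span k (coordForm W '' F)) +
        finrank k (Submodule.span k (coordForm (perp W) '' Fᶜ)) := by
  rw [span_transversal, finrank_submodule_prod]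

variable {W F}

theorem f_mem_span_transversal_iff {i : Fin n} :
    f W i ∈ Ideal.span (pairForm W '' transversal W F) ↔
      coordForm W i ∈ Submodule.span k (coordForm W '' F) := by
  rw [← pairForm_inl, map_mem_span_image_iff (isSymmetricAlgebra_pairForm W), span_transversal]
  simp

theorem g_mem_span_transversal_iff {i : Fin n} :
    g W i ∈ Ideal.span (pairForm W '' transversal W F) ↔
      coordForm (perp W) i ∈ Submodule.span k (coordForm (perp W) '' Fᶜ) := by
  rw [← pairForm_inr, map_mem_span_image_iff (isSymmetricAlgebra_pairForm W), span_transversal]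
  simp

theorem idealOfPairs_le_span_transversal :
    idealOfPairs W ≤ Ideal.span (pairForm W '' transversal W F) := by
  refine Ideal.span_le.2 ?_
  rintro _ ⟨i, rfl⟩
  by_cases hi : i ∈ F
  · refine Ideal.mul_mem_right _ _ (f_mem_span_transversal_iff.2 ?_)
    exact Submodule.subset_span ⟨i, hi, rfl⟩
  · refine Ideal.mul_mem_left _ _ (g_mem_span_transversal_iff.2 ?_)
    exact Submodule.subset_span ⟨i, hi, rfl⟩

theorem finrank_span_transversal_le_projectiveDimension
    (hf : ∀ i ∉ F, f W i ∉ Ideal.span (pairForm W '' transversal W F))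
    (hg : ∀ i ∈ F, g W i ∉ Ideal.span (pairForm W '' transversal W F)) :
    (finrank k (Submodule.span k (transversal W F)) : WithBot ℕ∞) ≤
      projectiveDimension (ModuleCat.of (PairRing W) (PairRing W ⧸ idealOfPairs W)) := by
  refine finrank_span_le_projectiveDimension (isSymmetricAlgebra_pairForm W)
    idealOfPairs_le_span_transversal ?_
  have hpair (i) : f W i * g W i ∈ idealOfPairs W := Ideal.subset_span ⟨i, rfl⟩
  rintro _ (⟨_, ⟨i, hi, rfl⟩, rfl⟩ | ⟨_, ⟨i, hi, rfl⟩, rfl⟩)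
  · exact ⟨g W i, hg i hi, by rw [pairForm_inl, mul_comm]; exact hpair i⟩
  · exact ⟨f W i, hf i hi, by rw [pairForm_inr]; exact hpair i⟩

theorem IsLinearRealization.eRk_add_eRk_dual_le_projectiveDimension {M : Matroid (Fin n)}
    (hW : IsLinearRealization W M) (hF : IsCyclicFlat M F) :
    (((M.eRk F).toNat + (M✶.eRk Fᶜ).toNat : ℕ) : WithBot ℕ∞) ≤
      projectiveDimension (ModuleCat.of (PairRing W) (PairRing W ⧸ idealOfPairs W)) := by
  have hFc : M✶.IsFlat Fᶜ := by
    simpa only [hW.1, ← Set.compl_eq_univ_sdiff] using hF.isFlat_dual_compl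
  rw [← hW.finrank_span_image, ← hW.dual.finrank_span_image, ← finrank_span_transversal]
  refine finrank_span_transversal_le_projectiveDimension (fun i hi => ?_) fun i hi => ?_
  · rw [f_mem_span_transversal_iff]
    exact hW.notMem_span_image_of_isFlat hF.1 hi
  · rw [g_mem_span_transversal_iff]
    exact hW.dual.notMem_span_image_of_isFlat hFc (not_not_intro hi)

end PairRing

end IdealOfPairs

theorem corollary3p8 {k : Type*} [Field k] {n : ℕ} (W : Submodule k (Fin n → k))
    (M : Matroid (Fin n)) (hW : IdealOfPairs.IsLinearRealization W M) :
    ∃ d : ℕ,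
      IsGreatest
        {z : ℤ | ∃ F : Set (Fin n), IdealOfPairs.IsCyclicFlat M F ∧
          z = 2 * ((M.eRk F).toNat : ℤ) - (F.ncard : ℤ) + (n : ℤ) - (M.eRank.toNat : ℤ)}
        (d : ℤ) ∧
      (d : WithBot ℕ∞) ≤
        CategoryTheory.projectiveDimension
          (ModuleCat.of (IdealOfPairs.PairRing W)
            (IdealOfPairs.PairRing W ⧸ IdealOfPairs.idealOfPairs W)) := by
  obtain ⟨F, hF, hmax⟩ := Set.exists_max_image {F | IdealOfPairs.IsCyclicFlat M F}
    (fun F => (M.eRk F).toNat + (M✶.eRk Fᶜ).toNat) (Set.toFinite _)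
    ⟨M.loops, IdealOfPairs.isCyclicFlat_loops M⟩
  simp only [← IdealOfPairs.toNat_eRk_add_toNat_eRk_dual hW.1]
  refine ⟨_, ⟨⟨F, hF, rfl⟩, ?_⟩, hW.eRk_add_eRk_dual_le_projectiveDimension hF⟩
  rintro _ ⟨F', hF', rfl⟩
  exact_mod_cast hmax F' hF'
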